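/- Let $\mathbb T$ be the circle group. For an abelian topological group $H$, let $\widehat H$ be the group of continuous homomorphisms $H\to\mathbb T$ with the compact-open topology; $H$ is called reflexive if $H$ is topologically isomorphic to $\widehat{\widehat H}$. The inverse limit of an inverse system of abelian topological groups $(H_i)_{i\in I}$ with continuous homomorphisms as bonding maps, over a nonempty directed index set $I$, is the subgroup of compatible families in $\prod_{i} H_i$ with the subspace topology of the product topology. Let $X=\mathbb Z^{\mathbb N}$ be the group of all integer sequences and let $G=\operatorname{Hom}(X,\mathbb Z)$ be the group of all group homomorphisms $X\to\mathbb Z$, viewed as a subgroup of $\mathbb Z^X$ with the topology of pointwise convergence ($\mathbb Z$ being discrete). For finite $A\subseteq X$ let $\pi_A:\mathbb Z^X\to\mathbb Z^A$ be the natural projection and $G_A=\pi_A(G)\subseteq\mathbb Z^A$, with the subspace topology. **Corollary 3.7.** An inverse limit of finitely generated torsion-free discrete abelian groups need not be reflexive; equally, an inverse limit of finitely generated free discrete abelian groups need not be reflexive. In particular, the claim that all inverse limits of compactly generated locally compact Hausdorff abelian groups are reflexive is false. More precisely: 1. For every finite $A\subseteq X$ the group $G_A$ is discrete, finitely generated,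 torsion-free and free abelian. 2. For finite $A\subseteq B\subseteq X$ there is a unique homomorphism $p^B_A:G_B\to G_A$ with $p^B_A(\pi_B(g))=\pi_A(g)$ for all $g\in G$, namely the restriction of coordinates from $B$ to $A$; it is continuous, and the groups $G_A$ with the maps $p^B_A$ form an inverse system over the finite subsets of $X$ ordered by inclusion. 3. The map $g\mapsto(\pi_A(g))_A$ is a topological isomorphism of $G$ onto the inverse limit $\varprojlim G_A$ of this system. 4. $G$, and hence $\varprojlim G_A$, is not reflexive. -/

import Mathlib

/-- An abelian topological group is reflexive if it is topologically isomorphic to its second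
Pontryagin dual. Mathlib's `PontryaginDual` is written multiplicatively; it consists of the
continuous characters into the circle, with the compact-open topology. -/
def IsReflexiveGroup (H : Type*) [AddCommGroup H] [TopologicalSpace H] : Prop :=
  Nonempty (Multiplicative H ≃ₜ* PontryaginDual (PontryaginDual (Multiplicative H)))

/-- The inverse limit of a family of abelian topological groups with bonding maps `f`:
the subgroup of compatible families in the product, with the subspace topology. -/
def inverseLimitGroup {ι : Type*} [Preorder ι] {F : ι → Type*} [∀ i, AddCommGroup (F i)]
    [∀ i, TopologicalSpace (F i)] (f : ∀ ⦃i j : ι⦄, i ≤ j → F j →ₜ+ F i) :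
    AddSubgroup (∀ i, F i) where
  carrier := {x | ∀ ⦃i j : ι⦄ (h : i ≤ j), f h (x j) = x i}
  zero_mem' := fun _ _ h => map_zero (f h)
  add_mem' := fun {x y} hx hy i j h => by
    rw [Pi.add_apply, Pi.add_apply, map_add, hx h, hy h]
  neg_mem' := fun {x} hx i j h => by
    rw [Pi.neg_apply, Pi.neg_apply, map_neg, hx h]

/-- Every inverse limit, over a nonempty directed index set, of abelian topological groups
in the class `P` is reflexive. -/
def InverseLimitsReflexive
    (P : ∀ (H : Type) [AddCommGroup H] [TopologicalSpace H], Prop) : Prop :=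
  ∀ (ι : Type) [Preorder ι] [IsDirectedOrder ι] [Nonempty ι] (F : ι → Type)
    [∀ i, AddCommGroup (F i)] [∀ i, TopologicalSpace (F i)] [∀ i, IsTopologicalAddGroup (F i)]
    (f : ∀ ⦃i j : ι⦄, i ≤ j → F j →ₜ+ F i),
    InverseSystem (fun _ _ h => ⇑(f h)) → (∀ i, P (F i)) →
      IsReflexiveGroup (inverseLimitGroup f)

/-- Finitely generated torsion-free discrete abelian groups. -/
def IsFGTorsionFreeDiscrete (H : Type) [AddCommGroup H] [TopologicalSpace H] : Prop :=
  DiscreteTopology H ∧ AddGroup.FG H ∧ IsAddTorsionFree H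

/-- Finitely generated free discrete abelian groups. -/
def IsFGFreeDiscrete (H : Type) [AddCommGroup H] [TopologicalSpace H] : Prop :=
  DiscreteTopology H ∧ AddGroup.FG H ∧ Module.Free ℤ H

/-- Compactly generated locally compact Hausdorff abelian groups
(generated as a group by a compact subset). -/
def IsCompactlyGeneratedLCA (H : Type) [AddCommGroup H] [TopologicalSpace H] : Prop :=
  LocallyCompactSpace H ∧ T2Space H ∧ ∃ K : Set H, IsCompact K ∧ AddSubgroup.closure K = ⊤

/-- The Baer-Specker group. -/
abbrev BaerSpecker : Type := ℕ → ℤ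

/-- The group of all homomorphisms from the Baer-Specker group to `ℤ`, as a subgroup of the power
`ℤ ^ BaerSpecker`. Its subspace topology is the topology of pointwise convergence, with `ℤ`
discrete. -/
def specGroup : AddSubgroup (BaerSpecker → ℤ) where
  carrier := {g | ∃ φ : BaerSpecker →+ ℤ, ⇑φ = g}
  zero_mem' := ⟨0, rfl⟩
  add_mem' := by
    rintro _ _ ⟨φ, rfl⟩ ⟨ψ, rfl⟩
    exact ⟨φ + ψ, rfl⟩
  neg_mem' := by
    rintro _ ⟨φ, rfl⟩
    exact ⟨-φ, rfl⟩

/-- The natural projection `ℤ ^ BaerSpecker → ℤ ^ A`. -/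
def coordProj (A : Finset BaerSpecker) : (BaerSpecker → ℤ) →+ (A → ℤ) where
  toFun := A.restrict
  map_zero' := rfl
  map_add' := fun _ _ => rfl

/-- The image `G_A` of `G = specGroup` in `ℤ ^ A`, with the subspace topology. -/
def specProj (A : Finset BaerSpecker) : AddSubgroup (A → ℤ) :=
  specGroup.map (coordProj A)

/-- The restriction `G → G_A` of the natural projection. -/
def toSpecProj (A : Finset BaerSpecker) : specGroup →+ specProj A where
  toFun g := ⟨coordProj A g, AddSubgroup.mem_map_of_mem _ g.2⟩
  map_zero' := rfl
  map_add' := fun _ _ => rfl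

/-- The bonding map `G_B → G_A` for `A ⊆ B`: forget the coordinates outside `A`. -/
def specBond ⦃A B : Finset BaerSpecker⦄ (h : A ≤ B) : specProj B →ₜ+ specProj A where
  toFun y := ⟨Finset.restrict₂ (π := fun _ => ℤ) h y, by
    obtain ⟨_, g, hg, rfl⟩ := y
    exact ⟨g, hg, rfl⟩⟩
  map_zero' := rfl
  map_add' := fun _ _ => rfl
  continuous_toFun := by
    have hc : Continuous fun y : specProj B =>
        Finset.restrict₂ (π := fun _ => ℤ) h (y : B → ℤ) :=
      (Finset.continuous_restrict₂ h).comp continuous_subtype_val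
    exact hc.subtype_mk _

/-! Let G be `specGroup`. By Specker, every homomorphism ℤ^ℕ → ℤ is a finite integral combination of
coordinates. Compact subsets of G are finite (`specGroup.finite_of_isCompact`), so the dual of G
embeds in 𝕋^ℕ with the product topology (`isInducing_dualCoords`). There the union of the coordinate
circles is compact, closed under powers, and generates a dense subgroup. A character mapping it into
the open right half-plane is therefore trivial, so the bidual is discrete. G is not discrete, so no
topological isomorphism between them exists. Finally, additivity involves only three arguments at a
time, so G is the limit of its finite projections. -/

/-! ### Homomorphisms from ℤ^ℕ to ℤ -/

/-- A homomorphism from the Baer-Specker group to `ℤ` that kills all unit vectors is zero. -/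
theorem BaerSpecker.eq_zero_of_single (φ : BaerSpecker →+ ℤ)
    (h : ∀ n, φ (Pi.single n 1) = 0) : φ = 0 := by
  have hfin : ∀ (m : ℕ) (x : BaerSpecker), (∀ n, m ≤ n → x n = 0) → φ x = 0 := by
    intro m x hx
    have : x = ∑ n ∈ Finset.range m, x n • (Pi.single n 1 : BaerSpecker) := by
      ext k
      rw [Finset.sum_apply]
      simp only [Pi.smul_apply, Pi.single_apply, smul_eq_mul, mul_ite, mul_one, mul_zero,
        Finset.sum_ite_eq, Finset.mem_range]
      split_ifs with hk
      · rfl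
      · exact hx k (not_lt.1 hk)
    rw [this, map_sum]
    exact Finset.sum_eq_zero fun n _ => by rw [map_zsmul, h, smul_zero]
  -- The first `m` terms contribute nothing and the tail is divisible by `p ^ m`, so the value is
  -- divisible by every power of `p`.
  have hpow : ∀ (p : ℤ), 1 < p → ∀ a : BaerSpecker, φ (fun n => p ^ n * a n) = 0 := by
    intro p hp a
    have hdvd : ∀ m : ℕ, p ^ m ∣ φ (fun n => p ^ n * a n) := by
      intro m
      have hsplit : (fun n => p ^ n * a n : BaerSpecker) =
          (fun n => if n < m then p ^ n * a n else 0) +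
            p ^ m • (fun n => if n < m then 0 else p ^ (n - m) * a n : BaerSpecker) := by
        ext n
        simp only [Pi.add_apply, Pi.smul_apply, smul_eq_mul]
        split_ifs with hn
        · simp
        · rw [zero_add, ← mul_assoc, ← pow_add, Nat.add_sub_cancel' (not_lt.1 hn)]
      rw [hsplit, map_add, hfin m _ (fun n hn => if_neg (not_lt.2 hn)), zero_add, map_zsmul,
        smul_eq_mul]
      exact dvd_mul_right _ _
    obtain ⟨m, hm⟩ := pow_unbounded_of_one_lt |φ (fun n => p ^ n * a n)| hp
    exact Int.eq_zero_of_abs_lt_dvd (hdvd m) hm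
  ext x
  have hco : ∀ n : ℕ, IsCoprime ((2 : ℤ) ^ n) (3 ^ n) := fun n =>
    IsCoprime.pow (by norm_num)
  choose a b hab using hco
  have hx : x = (fun n => 2 ^ n * (a n * x n)) + (fun n => 3 ^ n * (b n * x n)) := by
    ext n
    rw [Pi.add_apply]
    linear_combination (- x n) * hab n
  rw [hx, map_add, hpow 2 (by norm_num), hpow 3 (by norm_num)]
  simp

/-- A homomorphism from the Baer-Specker group to `ℤ` kills almost all unit vectors. -/
theorem BaerSpecker.finite_single_ne_zero (φ : BaerSpecker →+ ℤ) :
    {n : ℕ | φ (Pi.single n 1) ≠ 0}.Finite := by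
  classical
  by_contra hinf
  set S : Set ℕ := {n : ℕ | φ (Pi.single n 1) ≠ 0} with hS
  have : Infinite S := Set.infinite_coe_iff.2 hinf
  -- The quotient `c (k + 1) / c k` exceeds `|φ (Pi.single k 1)|`, so it cannot divide that value
  -- unless the value is zero.
  set c : ℕ → ℤ := fun n => ∏ i ∈ Finset.range n, (|φ (Pi.single i 1)| + 1) with hc
  have hcpos : ∀ n, 0 < c n := fun n => Finset.prod_pos fun i _ => by positivity
  have hcdvd : ∀ {m n}, m ≤ n → c m ∣ c n := fun {m n} h =>
    Finset.prod_dvd_prod_of_subset _ _ _ (Finset.range_mono h)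
  let v : Set S → BaerSpecker := fun s n => if n ∈ (Subtype.val '' s) then c n else 0
  -- Injectivity would embed the uncountable power set of `S` in ℤ. If two values agree, reduce
  -- modulo `c (k + 1)` at the first difference `k`: only `± c k` times the `k`-th unit vector
  -- survives.
  have hinj : Function.Injective fun s => φ (v s) := by
    intro s t hst
    by_contra hne
    have hne' : ∃ n, v s n ≠ v t n := by
      by_contra! hall
      refine hne (Subtype.val_injective.image_injective (Set.ext fun n => ?_))
      have hn := hall n
      have h0 := (hcpos n).ne'
      simp only [v] at hn
      split_ifs at hn <;> simp_all
    set k := Nat.find hne' with hk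
    have hk1 : v s k ≠ v t k := Nat.find_spec hne'
    have hk2 : ∀ n < k, v s n = v t n := fun n hn => not_not.1 (Nat.find_min hne' hn)
    have hkS : φ (Pi.single k 1) ≠ 0 := by
      by_contra h0
      have hmem : ∀ r : Set S, k ∉ Subtype.val '' r := by
        rintro r ⟨y, -, hy⟩
        exact y.2 (hy ▸ h0)
      exact hk1 (by simp only [v, if_neg (hmem _)])
    have hdiv : ∀ n, c (k + 1) ∣ (v s - v t - (v s k - v t k) • Pi.single k 1 : BaerSpecker) n := by
      intro n
      rcases lt_trichotomy n k with hn | hn | hn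
      · simp [hk2 n hn, hn.ne]
      · simp [hn]
      · have h1 : ∀ r, c (k + 1) ∣ v r n := fun r => by
          simp only [v]
          split_ifs
          · exact hcdvd hn
          · exact dvd_zero _
        simpa [hn.ne'] using dvd_sub (h1 s) (h1 t)
    choose w hw using hdiv
    have hφ := congrArg φ (show (v s - v t - (v s k - v t k) • Pi.single k 1 : BaerSpecker)
      = c (k + 1) • w from funext hw)
    have hst' : φ (v s) = φ (v t) := hst
    rw [map_sub, map_sub, hst', sub_self, zero_sub, map_zsmul, map_zsmul, smul_eq_mul,
      smul_eq_mul] at hφ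
    have hd : c (k + 1) ∣ c k * φ (Pi.single k 1) := by
      have hcases : v s k - v t k = c k ∨ v s k - v t k = - c k := by
        simp only [v] at hk1 ⊢
        split_ifs at hk1 ⊢ <;> simp_all
      rcases hcases with h | h <;> rw [h] at hφ
      · exact ⟨-φ w, by linarith⟩
      · exact ⟨φ w, by linarith⟩
    have hsucc : c (k + 1) = c k * (|φ (Pi.single k 1)| + 1) := Finset.prod_range_succ _ _
    rw [hsucc] at hd
    have := (mul_dvd_mul_iff_left (hcpos k).ne').1 hd
    exact hkS (Int.eq_zero_of_abs_lt_dvd this (lt_add_one _))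
  obtain ⟨i, hi⟩ : ∃ i : ℤ → S, Function.Injective i :=
    ⟨fun z => Infinite.natEmbedding S (Encodable.encode z),
      (Infinite.natEmbedding S).injective.comp Encodable.encode_injective⟩
  exact Function.cantor_injective _ (hi.comp hinj)


theorem BaerSpecker.hom_ext {φ ψ : BaerSpecker →+ ℤ}
    (h : ∀ n, φ (Pi.single n 1) = ψ (Pi.single n 1)) : φ = ψ :=
  sub_eq_zero.1 (BaerSpecker.eq_zero_of_single _ fun n => by simp [h n])

theorem BaerSpecker.apply_eq_sum {φ : BaerSpecker →+ ℤ} {N : ℕ}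
    (h : ∀ n, N ≤ n → φ (Pi.single n 1) = 0) (x : BaerSpecker) :
    φ x = ∑ n ∈ Finset.range N, φ (Pi.single n 1) * x n := by
  have hφ : φ = ∑ n ∈ Finset.range N,
      φ (Pi.single n 1) • Pi.evalAddMonoidHom (fun _ : ℕ => ℤ) n := by
    refine hom_ext fun k => ?_
    simp only [AddMonoidHom.finsetSum_apply, AddMonoidHom.smul_apply, Pi.evalAddMonoidHom_apply,
      Pi.single_apply, smul_eq_mul, mul_ite, mul_one, mul_zero]
    by_cases hk : k < N
    · simp [hk]
    · rw [h k (not_lt.1 hk)]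
      exact (Finset.sum_eq_zero fun n hn => if_neg (by have := Finset.mem_range.1 hn; omega)).symm
  have := DFunLike.congr_fun hφ x
  rw [this]
  simp [AddMonoidHom.finsetSum_apply]

theorem BaerSpecker.exists_forall_ge_eq_zero (φ : BaerSpecker →+ ℤ) :
    ∃ N, ∀ n, N ≤ n → φ (Pi.single n 1) = 0 := by
  obtain ⟨N, hN⟩ := (finite_single_ne_zero φ).bddAbove
  refine ⟨N + 1, fun n hn => ?_⟩
  by_contra h
  have : n ≤ N := hN h
  omega

/-! ### Compact subsets of G are finite, yet G is not discrete -/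

/-- A sequence growing so fast that every lower triangular integral matrix `d` with nonzero
diagonal maps it to an unbounded sequence. -/
def dominatingSeq (d : ℕ → ℕ → ℤ) : ℕ → ℤ
  | m => m + |∑ n : Fin m, d m n * dominatingSeq d n|
decreasing_by exact n.2

/-- The diagonal term is at least `m + |s|` in absolute value, where `s` is the sum of the earlier
terms, so `s` cannot cancel more than `|s|` of it. -/
theorem le_abs_sum_mul_dominatingSeq (d : ℕ → ℕ → ℤ) {m : ℕ} (hm : d m m ≠ 0) :
    (m : ℤ) ≤ |∑ n ∈ Finset.range (m + 1), d m n * dominatingSeq d n| := by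
  rw [Finset.sum_range_succ]
  set s := ∑ n ∈ Finset.range m, d m n * dominatingSeq d n with hs
  have hx : dominatingSeq d m = m + |s| := by
    rw [dominatingSeq, hs, Finset.sum_range]
  have h1 : (m : ℤ) + |s| ≤ |d m m * dominatingSeq d m| := by
    rw [hx, abs_mul, abs_of_nonneg (by positivity : (0 : ℤ) ≤ m + |s|)]
    exact le_mul_of_one_le_left (by positivity) (Int.one_le_abs hm)
  have h2 := abs_sub_abs_le_abs_sub (d m m * dominatingSeq d m) (-s)
  rw [abs_neg, sub_neg_eq_add, add_comm _ s] at h2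
  linarith

/-- A pointwise finite set of homomorphisms from the Baer-Specker group to `ℤ` is finite. -/
theorem BaerSpecker.finite_of_pointwise_finite (C : Set (BaerSpecker →+ ℤ))
    (hC : ∀ x, ((fun φ : BaerSpecker →+ ℤ => φ x) '' C).Finite) : C.Finite := by
  classical
  by_cases hb : ∃ N, ∀ φ ∈ C, ∀ n, N ≤ n → φ (Pi.single n 1) = 0
  · obtain ⟨N, hN⟩ := hb
    have hfin : {f : Fin N → ℤ | ∀ n : Fin N,
        f n ∈ (fun φ : BaerSpecker →+ ℤ => φ (Pi.single (n : ℕ) 1)) '' C}.Finite :=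
      Set.Finite.pi' fun n => hC _
    refine Set.Finite.of_finite_image (hfin.subset
      (t := (fun (φ : BaerSpecker →+ ℤ) (n : Fin N) => φ (Pi.single (n : ℕ) 1)) '' C) ?_) ?_
    · rintro _ ⟨φ, hφ, rfl⟩ n
      exact ⟨φ, hφ, rfl⟩
    · intro φ hφ ψ hψ h
      refine hom_ext fun n => ?_
      by_cases hn : n < N
      · exact congrFun h ⟨n, hn⟩
      · rw [hN φ hφ n (not_lt.1 hn), hN ψ hψ n (not_lt.1 hn)]
  · exfalso
    push Not at hb
    -- The last index of the support is unbounded over `C`. One functional per attained last index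
    -- gives the rows of a triangular matrix.
    have htop : ∀ N, ∃ m, N ≤ m ∧ ∃ φ ∈ C, φ (Pi.single m 1) ≠ 0 ∧
        ∀ n, m + 1 ≤ n → φ (Pi.single n 1) = 0 := by
      intro N
      obtain ⟨φ, hφ, n, hn, hne⟩ := hb N
      obtain ⟨M, hM⟩ := exists_forall_ge_eq_zero φ
      have hnM : n ≤ M := by
        by_contra h
        exact hne (hM n (by omega))
      refine ⟨Nat.findGreatest (fun k => φ (Pi.single k 1) ≠ 0) M,
        hn.trans (Nat.le_findGreatest hnM hne), φ, hφ,
        Nat.findGreatest_spec (P := fun k => φ (Pi.single k 1) ≠ 0) hnM hne, fun k hk => ?_⟩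
      by_cases hkM : k ≤ M
      · exact not_not.1 (Nat.findGreatest_is_greatest hk hkM)
      · exact hM k (by omega)
    let T : ℕ → (BaerSpecker →+ ℤ) → Prop := fun m φ => φ ∈ C ∧ φ (Pi.single m 1) ≠ 0 ∧
        ∀ n, m + 1 ≤ n → φ (Pi.single n 1) = 0
    -- Rows whose index is no last index are arbitrary; the lower bound is used only at an attained
    -- `m`.
    let ψ : ℕ → BaerSpecker →+ ℤ := fun m => Classical.epsilon (T m)
    let d : ℕ → ℕ → ℤ := fun m n => ψ m (Pi.single n 1)
    obtain ⟨B, hB⟩ := ((hC (dominatingSeq d)).image abs).bddAbove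
    obtain ⟨m, hm, φ, hφ⟩ := htop (B.toNat + 1)
    have hT : T m (ψ m) := Classical.epsilon_spec (p := T m) ⟨φ, hφ⟩
    have h1 := hB ⟨_, ⟨ψ m, hT.1, rfl⟩, rfl⟩
    have h2 := le_abs_sum_mul_dominatingSeq d hT.2.1
    have h3 : (m : ℤ) ≤ B := h2.trans
      (le_of_eq_of_le (congrArg abs (apply_eq_sum hT.2.2 (dominatingSeq d)).symm) h1)
    omega

/-- Every compact subset of `specGroup` is finite. -/
theorem specGroup.finite_of_isCompact {C : Set specGroup} (hC : IsCompact C) : C.Finite := by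
  have hpre : ((fun φ : BaerSpecker →+ ℤ => (⟨φ, φ, rfl⟩ : specGroup)) ⁻¹' C).Finite := by
    refine BaerSpecker.finite_of_pointwise_finite _ fun x => ?_
    have hx : Continuous fun g : specGroup => g.1 x :=
      (continuous_apply x).comp continuous_subtype_val
    refine (isCompact_iff_finite.1 (hC.image hx)).subset ?_
    rintro _ ⟨φ, hφ, rfl⟩
    exact ⟨_, hφ, rfl⟩
  refine (hpre.image fun φ : BaerSpecker →+ ℤ => (⟨φ, φ, rfl⟩ : specGroup)).subset ?_
  rintro ⟨_, φ, rfl⟩ hg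
  exact ⟨φ, hg, rfl⟩

/-- The coordinate functionals in `specGroup`. -/
def specGroup.coord (n : ℕ) : specGroup :=
  ⟨fun x => x n, Pi.evalAddMonoidHom (fun _ : ℕ => ℤ) n, rfl⟩

theorem specGroup.exists_eq_sum (g : specGroup) :
    ∃ N, (∀ n, N ≤ n → g.1 (Pi.single n 1) = 0) ∧
      g = ∑ n ∈ Finset.range N, g.1 (Pi.single n 1) • coord n := by
  obtain ⟨_, φ, rfl⟩ := g
  obtain ⟨N, hN⟩ := BaerSpecker.exists_forall_ge_eq_zero φ
  refine ⟨N, hN, Subtype.ext (funext fun x => ?_)⟩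
  simp only [AddSubgroup.val_finsetSum, Finset.sum_apply, AddSubgroup.coe_zsmul, Pi.smul_apply,
    coord, smul_eq_mul]
  exact BaerSpecker.apply_eq_sum hN x

/-- `specGroup` is not discrete: finitely many sequences have a common nonzero annihilator. -/
theorem specGroup.not_discreteTopology : ¬ DiscreteTopology specGroup := by
  intro hd
  have h0 : IsOpen ({0} : Set specGroup) := isOpen_discrete _
  obtain ⟨U, hU, hU0⟩ := isOpen_induced_iff.1 h0
  have hmem : (0 : BaerSpecker → ℤ) ∈ U := by
    have : (0 : specGroup) ∈ Subtype.val ⁻¹' U := by rw [hU0]; rfl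
    exact this
  obtain ⟨A, u, hu, hAU⟩ := isOpen_pi_iff.1 hU _ hmem
  -- With one more unknown than equations, some nonzero combination of coordinates vanishes on `A`.
  let L : (Fin (A.card + 1) → ℤ) →ₗ[ℤ] (A → ℤ) :=
    { toFun := fun c x => ∑ i, c i * x.1 i
      map_add' := fun c c' => by ext; simp [add_mul, Finset.sum_add_distrib]
      map_smul' := fun r c => by ext; simp [Finset.mul_sum, mul_assoc] }
  have hker : ¬ Function.Injective L := fun hinj => by
    have := LinearMap.finrank_le_finrank_of_injective hinj
    simp at this
  obtain ⟨c, hc, hc0⟩ : ∃ c, L c = 0 ∧ c ≠ 0 := by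
    by_contra! hall
    exact hker ((injective_iff_map_eq_zero L).2 hall)
  let g : specGroup := ∑ i, c i • coord i
  have hg : ∀ x, g.1 x = ∑ i, c i * x i := fun x => by
    simp [g, coord, Finset.sum_apply]
  have hgU : g ∈ Subtype.val ⁻¹' U := hAU fun x hx => by
    have := congrFun hc ⟨x, hx⟩
    rw [hg]
    change ∑ i, c i * x i = 0 at this
    rw [this]
    exact (hu x hx).2
  rw [hU0] at hgU
  refine hc0 (funext fun j => ?_)
  have hj := hg (Pi.single j 1)
  rw [show g = 0 from hgU] at hj
  simpa [Pi.single_apply, Fin.val_inj] using hj.symm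

/-! ### The dual and the bidual of G -/

/-- While the real part `r` is positive, squaring at least doubles `1 - r`, because `1 - (2r² - 1) =
2(1 - r)(1 + r)`. -/
theorem Circle.eq_one_of_forall_pow_re_pos {z : Circle}
    (h : ∀ n : ℕ, 0 < ((z ^ n : Circle) : ℂ).re) :
    z = 1 := by
  have hsq : ∀ w : Circle, ((w ^ 2 : Circle) : ℂ).re = 2 * (w : ℂ).re ^ 2 - 1 := fun w => by
    have := Circle.normSq_coe w
    rw [Complex.normSq_apply] at this
    rw [Circle.coe_pow, pow_two, Complex.mul_re]
    linarith
  have hgrow : ∀ n : ℕ, 2 ^ n * (1 - (z : ℂ).re) ≤ 1 - ((z ^ 2 ^ n : Circle) : ℂ).re := by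
    intro n
    induction n with
    | zero => simp
    | succ n ih =>
      have hz : z ^ 2 ^ (n + 1) = (z ^ 2 ^ n) ^ 2 := by rw [pow_succ, pow_mul]
      rw [hz, hsq]
      have h1 := h (2 ^ n)
      have h2 : ((z ^ 2 ^ n : Circle) : ℂ).re ≤ 1 :=
        (Complex.re_le_norm _).trans_eq (Circle.norm_coe _)
      have h3 : (2 : ℝ) ^ (n + 1) * (1 - (z : ℂ).re) = 2 * (2 ^ n * (1 - (z : ℂ).re)) := by ring
      nlinarith
  have hle : (z : ℂ).re ≤ 1 := (Complex.re_le_norm _).trans_eq (Circle.norm_coe _)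
  have hre : (z : ℂ).re = 1 := by
    by_contra hne
    have hpos : 0 < 1 - (z : ℂ).re := sub_pos.2 (lt_of_le_of_ne hle hne)
    obtain ⟨n, hn⟩ := pow_unbounded_of_one_lt (1 / (1 - (z : ℂ).re)) one_lt_two
    rw [div_lt_iff₀ hpos] at hn
    have := hgrow n
    have := h (2 ^ n)
    linarith
  have hn := Circle.normSq_coe z
  rw [Complex.normSq_apply, hre] at hn
  refine Circle.ext (Complex.ext (by simpa using hre) ?_)
  have : (z : ℂ).im * (z : ℂ).im = 0 := by linarith
  simpa using this

open Topology
namespace specGroup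
/-- The dual of `specGroup`. -/
abbrev Dual : Type := PontryaginDual (Multiplicative specGroup)

/-- The values of a character of `specGroup` at the coordinate functionals. -/
noncomputable def dualCoords (d : Dual) (n : ℕ) : Circle := d (Multiplicative.ofAdd (coord n))

/-- The bound `N` does not depend on `d`, so evaluation at `g` is continuous in finitely many
coordinates of `d`. -/
theorem dual_apply_eq_prod (g : specGroup) : ∃ N, ∀ d : Dual, d (Multiplicative.ofAdd g) =
    ∏ n ∈ Finset.range N, dualCoords d n ^ g.1 (Pi.single n 1) := by
  obtain ⟨N, -, hN⟩ := exists_eq_sum g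
  refine ⟨N, fun d => ?_⟩
  conv_lhs => rw [hN]
  rw [ofAdd_sum, map_prod]
  simp only [ofAdd_zsmul, map_zpow, dualCoords]

theorem continuous_dualCoords : Continuous dualCoords :=
  continuous_pi fun n => (continuous_eval_const (F := C(Multiplicative specGroup, Circle))
    (Multiplicative.ofAdd (coord n))).comp
      (ContinuousMonoidHom.isInducing_toContinuousMap _ _).continuous

/-- As all compact subsets of `specGroup` are finite, the topology of its dual is that of pointwise
convergence on the coordinate functionals. -/
theorem isInducing_dualCoords : IsInducing dualCoords := by
  refine ⟨le_antisymm continuous_dualCoords.le_induced ?_⟩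
  let t : TopologicalSpace Dual := .induced dualCoords inferInstance
  have hc : ∀ g : Multiplicative specGroup, Continuous[t, _] fun d : Dual => d g := by
    intro g
    obtain ⟨N, hN⟩ := dual_apply_eq_prod g.toAdd
    have hcoord : ∀ n, Continuous[t, _] fun d : Dual => dualCoords d n := fun n =>
      (continuous_apply (A := fun _ : ℕ => Circle) n).comp
        (continuous_induced_dom (f := dualCoords))
    have : (fun d : Dual => d g) = fun d =>
        ∏ n ∈ Finset.range N, dualCoords d n ^ g.toAdd.1 (Pi.single n 1) := funext hN
    rw [this]
    exact continuous_finsetProd _ fun n _ => (hcoord n).zpow _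
  refine continuous_id_iff_le.1 ?_
  refine (ContinuousMonoidHom.isInducing_toContinuousMap _ _).continuous_iff.2 ?_
  refine ContinuousMap.continuous_compactOpen.2 fun K hK U hU => ?_
  have hKfin : K.Finite := finite_of_isCompact (C := K) hK
  have : {d : Dual | Set.MapsTo d K U} = ⋂ g ∈ K, {d : Dual | d g ∈ U} := by
    ext d; simp [Set.MapsTo]
  change IsOpen[t] {d : Dual | Set.MapsTo d K U}
  rw [this]
  exact hKfin.isOpen_biInter fun g _ => hU.preimage (hc g)

/-- The character of `specGroup` with value `t` at the `n`-th coordinate functional and trivial at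
the others. -/
noncomputable def dualSingle (n : ℕ) (t : Circle) : Dual where
  toFun g := t ^ g.toAdd.1 (Pi.single n 1)
  map_one' := zpow_zero t
  map_mul' _ _ := zpow_add t _ _
  continuous_toFun := (continuous_of_discreteTopology (f := fun k : ℤ => t ^ k)).comp
    ((continuous_apply _).comp continuous_subtype_val)

theorem dualCoords_dualSingle (n : ℕ) (t : Circle) :
    dualCoords (dualSingle n t) = Pi.mulSingle n t := by
  ext1 m
  change t ^ (Pi.single n 1 : ℕ → ℤ) m = _
  rcases eq_or_ne m n with rfl | h
  · simp
  · simp [h]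

theorem dualCoords_mul (d d' : Dual) : dualCoords (d * d') = dualCoords d * dualCoords d' := rfl

theorem dualSingle_mul (n : ℕ) (s t : Circle) :
    dualSingle n (s * t) = dualSingle n s * dualSingle n t :=
  PontryaginDual.ext fun _ => mul_zpow s t _

theorem dualSingle_pow (n : ℕ) (t : Circle) (k : ℕ) :
    dualSingle n t ^ k = dualSingle n (t ^ k) := by
  have h1 : dualSingle n 1 = 1 := PontryaginDual.ext fun _ => one_zpow _
  exact (map_pow (⟨⟨dualSingle n, h1⟩, dualSingle_mul n⟩ : Circle →* Dual) t k).symm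

/-- The union of the coordinate circles in the dual of `specGroup`. -/
def dualAxes : Set Dual := {d | ∃ n t, d = dualSingle n t}

/-- In the compact space 𝕋^ℕ the axes form a closed set: of any two coordinates, one is 1. All its
points are attained by `dualCoords`, so compactness pulls back. -/
theorem isCompact_dualAxes : IsCompact dualAxes := by
  let K : Set (ℕ → Circle) := {z | ∀ m n, m ≠ n → z m = 1 ∨ z n = 1}
  have hK : IsClosed K := by
    simp only [K, Set.ofPred_forall]
    refine isClosed_iInter fun m => isClosed_iInter fun n => isClosed_iInter fun _ => ?_
    exact (isClosed_eq (continuous_apply m) continuous_const).union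
      (isClosed_eq (continuous_apply n) continuous_const)
  have hsingle : ∀ z ∈ K, ∃ n t, z = Pi.mulSingle n t := by
    intro z hz
    by_cases h : ∃ n, z n ≠ 1
    · obtain ⟨n, hn⟩ := h
      refine ⟨n, z n, funext fun m => ?_⟩
      rcases eq_or_ne m n with rfl | hmn
      · simp
      · rw [Pi.mulSingle_eq_of_ne hmn]
        exact (hz m n hmn).resolve_right hn
    · push Not at h
      exact ⟨0, 1, by rw [Pi.mulSingle_one]; exact funext h⟩
  have hinj : Function.Injective dualCoords := fun d d' h => PontryaginDual.ext fun g => by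
    obtain ⟨N, hN⟩ := dual_apply_eq_prod g.toAdd
    exact (hN d).trans (h ▸ (hN d').symm)
  have heq : dualAxes = dualCoords ⁻¹' K := by
    ext d
    constructor
    · rintro ⟨n, t, rfl⟩ i j hij
      rw [dualCoords_dualSingle]
      by_contra! hne
      have key : ∀ k, (Pi.mulSingle n t : ℕ → Circle) k ≠ 1 → k = n := fun k hk => by
        by_contra h
        exact hk (Pi.mulSingle_eq_of_ne h _)
      exact hij ((key i hne.1).trans (key j hne.2).symm)
    · intro hd
      obtain ⟨n, t, h⟩ := hsingle _ hd
      exact ⟨n, t, hinj (h.trans (dualCoords_dualSingle n t).symm)⟩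
  rw [heq]
  refine (isInducing_dualCoords.isCompact_preimage_iff fun z hz => ?_).2 hK.isCompact
  obtain ⟨n, t, rfl⟩ := hsingle z hz
  exact ⟨_, dualCoords_dualSingle n t⟩

/-- Characters of the dual of `specGroup` are determined on the coordinate circles. -/
theorem bidual_eq_one {χ : PontryaginDual Dual} (h : ∀ n t, χ (dualSingle n t) = 1) : χ = 1 := by
  refine PontryaginDual.ext fun d => ?_
  -- Each coordinate of these partial products is eventually that of `d`, so they converge to `d`.
  let e : ℕ → Dual := fun m => ∏ n ∈ Finset.range m, dualSingle n (dualCoords d n)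
  have he : Filter.Tendsto e Filter.atTop (𝓝 d) := by
    rw [isInducing_dualCoords.tendsto_nhds_iff, tendsto_pi_nhds]
    intro k
    refine tendsto_const_nhds.congr' ?_
    filter_upwards [Filter.eventually_gt_atTop k] with m hm
    have hprod : ∀ s : Finset ℕ, dualCoords (∏ n ∈ s, dualSingle n (dualCoords d n)) =
        ∏ n ∈ s, Pi.mulSingle n (dualCoords d n) := by
      intro s
      classical
      induction s using Finset.induction_on with
      | empty => rfl
      | insert a s ha ih =>
        rw [Finset.prod_insert ha, Finset.prod_insert ha, dualCoords_mul, ih,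
          dualCoords_dualSingle]
    simp only [Function.comp_apply, e, hprod, Finset.prod_apply]
    rw [Finset.prod_eq_single_of_mem k (Finset.mem_range.2 hm) fun b _ hb =>
      Pi.mulSingle_eq_of_ne hb.symm _, Pi.mulSingle_eq_same]
  have hχ : ∀ m, χ (e m) = 1 := fun m => by
    simp only [e, map_prod, h, Finset.prod_const_one]
  have := ((map_continuous χ).tendsto d).comp he
  exact tendsto_nhds_unique this (by simp [Function.comp_def, hχ])

/-- The basic neighbourhood of 1 given by `dualAxes` and the right half-plane is `{1}`: the axes are
closed under powers, and the half-plane contains no nontrivial subgroup of the circle. -/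
theorem discreteTopology_bidual : DiscreteTopology (PontryaginDual Dual) := by
  refine discreteTopology_of_isOpen_singleton_one ?_
  have hU : IsOpen {z : Circle | 0 < (z : ℂ).re} :=
    isOpen_lt continuous_const (Complex.continuous_re.comp continuous_subtype_val)
  have hopen := (ContinuousMap.isOpen_setOfPred_mapsTo isCompact_dualAxes hU).preimage
    (ContinuousMonoidHom.isInducing_toContinuousMap Dual Circle).continuous
  refine (congrArg IsOpen (Set.ext fun χ => ?_)).mpr hopen
  constructor
  · rintro rfl d -
    change 0 < ((1 : Circle) : ℂ).re
    simp
  · intro hχ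
    refine bidual_eq_one fun n t => Circle.eq_one_of_forall_pow_re_pos fun k => ?_
    rw [← map_pow, dualSingle_pow]
    exact hχ ⟨n, t ^ k, rfl⟩

theorem not_isReflexiveGroup : ¬ IsReflexiveGroup specGroup := by
  rintro ⟨h⟩
  have := discreteTopology_bidual
  have hd : DiscreteTopology (Multiplicative specGroup) :=
    h.toHomeomorph.isEmbedding.discreteTopology
  exact not_discreteTopology hd

end specGroup

/-! ### The finite projections and their inverse limit -/

theorem IsReflexiveGroup.of_equiv {H K : Type*} [AddCommGroup H] [TopologicalSpace H]
    [AddCommGroup K] [TopologicalSpace K] (e : H ≃ₜ+ K) (h : IsReflexiveGroup K) :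
    IsReflexiveGroup H := by
  obtain ⟨f⟩ := h
  let e' : Multiplicative H ≃ₜ* Multiplicative K :=
    { AddEquiv.toMultiplicative e.toAddEquiv with
      continuous_toFun := e.continuous_toFun
      continuous_invFun := e.continuous_invFun }
  let d : PontryaginDual (Multiplicative K) ≃ₜ* PontryaginDual (Multiplicative H) :=
    { toFun := fun χ => ContinuousMonoidHom.comp χ (e' : Multiplicative H →ₜ* Multiplicative K)
      invFun := fun χ =>
        ContinuousMonoidHom.comp χ (e'.symm : Multiplicative K →ₜ* Multiplicative H)
      left_inv := fun χ => PontryaginDual.ext fun x => congrArg χ (e'.apply_symm_apply x)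
      right_inv := fun χ => PontryaginDual.ext fun x => congrArg χ (e'.symm_apply_apply x)
      map_mul' := fun _ _ => rfl
      continuous_toFun := ContinuousMonoidHom.continuous_comp_left _
      continuous_invFun := ContinuousMonoidHom.continuous_comp_left _ }
  let dd : PontryaginDual (PontryaginDual (Multiplicative K)) ≃ₜ*
      PontryaginDual (PontryaginDual (Multiplicative H)) :=
    { toFun := fun χ => ContinuousMonoidHom.comp χ
        (d.symm : PontryaginDual (Multiplicative H) →ₜ* PontryaginDual (Multiplicative K))
      invFun := fun χ => ContinuousMonoidHom.comp χ
        (d : PontryaginDual (Multiplicative K) →ₜ* PontryaginDual (Multiplicative H))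
      left_inv := fun χ => PontryaginDual.ext fun x => congrArg χ (d.symm_apply_apply x)
      right_inv := fun χ => PontryaginDual.ext fun x => congrArg χ (d.apply_symm_apply x)
      map_mul' := fun _ _ => rfl
      continuous_toFun := ContinuousMonoidHom.continuous_comp_left _
      continuous_invFun := ContinuousMonoidHom.continuous_comp_left _ }
  exact ⟨(e'.trans f).trans dd⟩

instance specProj.discreteTopology (A : Finset BaerSpecker) : DiscreteTopology (specProj A) :=
  inferInstance

theorem specProj.fg (A : Finset BaerSpecker) : AddGroup.FG (specProj A) :=
  Module.Finite.iff_addGroup_fg.1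
    (inferInstanceAs (Module.Finite ℤ (AddSubgroup.toIntSubmodule (specProj A))))

theorem specProj.free (A : Finset BaerSpecker) : Module.Free ℤ (specProj A) :=
  inferInstanceAs (Module.Free ℤ (AddSubgroup.toIntSubmodule (specProj A)))

theorem specProj.isAddTorsionFree (A : Finset BaerSpecker) : IsAddTorsionFree (specProj A) :=
  inferInstance

theorem specProj.isCompactlyGeneratedLCA (A : Finset BaerSpecker) :
    IsCompactlyGeneratedLCA (specProj A) := by
  obtain ⟨S, hS⟩ := (specProj.fg A).out
  exact ⟨inferInstance, inferInstance, S, S.finite_toSet.isCompact, hS⟩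

theorem toSpecProj_surjective (A : Finset BaerSpecker) : Function.Surjective (toSpecProj A) := by
  rintro ⟨_, g, hg, rfl⟩
  exact ⟨⟨g, hg⟩, rfl⟩

theorem inverseSystem_specBond : InverseSystem (fun _ _ h => ⇑(specBond h)) where
  map_self _ _ := rfl
  map_map _ _ _ _ _ _ := rfl

/-- The natural map from `specGroup` to the inverse limit of its finite projections. -/
def specGroupEquivLimit : specGroup ≃ₜ+ inverseLimitGroup specBond where
  toFun g := ⟨fun A => toSpecProj A g, fun _ _ _ => rfl⟩
  invFun y := ⟨fun x => (y.1 {x}).1 ⟨x, Finset.mem_singleton_self x⟩, by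
    classical
    have hy : ∀ (A : Finset BaerSpecker) (x) (hx : x ∈ A),
        (y.1 {x}).1 ⟨x, Finset.mem_singleton_self x⟩ = (y.1 A).1 ⟨x, hx⟩ := fun A x hx => by
      rw [← y.2 (Finset.singleton_subset_iff.2 hx)]
      rfl
    refine ⟨AddMonoidHom.mk' _ fun a b => ?_, rfl⟩
    -- On this finite set the compatible family agrees with a genuine homomorphism, which gives
    -- additivity at `a` and `b`.
    let A : Finset BaerSpecker := {a, b, a + b}
    obtain ⟨_, ⟨φ, rfl⟩, hφ⟩ := (y.1 A).2
    have hA : ∀ x (hx : x ∈ A), (y.1 A).1 ⟨x, hx⟩ = φ x := fun x hx => by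
      rw [← hφ]
      rfl
    have hφy : ∀ x ∈ A, (y.1 {x}).1 ⟨x, Finset.mem_singleton_self x⟩ = φ x := fun x hx =>
      (hy A x hx).trans (hA x hx)
    exact (hφy (a + b) (by simp [A])).trans ((map_add φ a b).trans
      (congrArg₂ (· + ·) (hφy a (by simp [A])) (hφy b (by simp [A]))).symm)⟩
  left_inv _ := rfl
  right_inv y := by
    refine Subtype.ext (funext fun A => Subtype.ext (funext fun x => ?_))
    have h := y.2 (Finset.singleton_subset_iff.2 x.2)
    exact congrFun (congrArg Subtype.val h.symm) ⟨x.1, Finset.mem_singleton_self x.1⟩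
  map_add' _ _ := rfl
  continuous_toFun := Continuous.subtype_mk (continuous_pi fun _ => Continuous.subtype_mk
    (continuous_pi fun x => (continuous_apply x.1).comp continuous_subtype_val) _) _
  continuous_invFun := by
    refine Continuous.subtype_mk (continuous_pi fun x => ?_) _
    have hx : Continuous fun y : inverseLimitGroup specBond =>
        (y.1 ({x} : Finset BaerSpecker)).1 :=
      continuous_subtype_val.comp ((continuous_apply _).comp continuous_subtype_val)
    exact (continuous_apply _).comp hx

theorem not_isReflexiveGroup_limit : ¬ IsReflexiveGroup (inverseLimitGroup specBond) :=
  fun h => specGroup.not_isReflexiveGroup (h.of_equiv specGroupEquivLimit)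

theorem not_inverseLimitsReflexive_of_specProj
    {P : ∀ (H : Type) [AddCommGroup H] [TopologicalSpace H], Prop} (h : ∀ A, P (specProj A)) :
    ¬ InverseLimitsReflexive P := fun hP =>
  not_isReflexiveGroup_limit
    (hP (Finset BaerSpecker) (fun A => specProj A) specBond inverseSystem_specBond h)

theorem corollary3p7 :
    -- inverse limits of finitely generated torsion-free (free) discrete groups,
    -- and of compactly generated LCA groups, need not be reflexive
    ¬ InverseLimitsReflexive IsFGTorsionFreeDiscrete ∧
    ¬ InverseLimitsReflexive IsFGFreeDiscrete ∧
    ¬ InverseLimitsReflexive IsCompactlyGeneratedLCA ∧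
    -- the projections of the witness
    (∀ A : Finset BaerSpecker, DiscreteTopology (specProj A) ∧ AddGroup.FG (specProj A) ∧
      IsAddTorsionFree (specProj A) ∧ Module.Free ℤ (specProj A)) ∧
    -- the bonding maps are the unique ones compatible with the projections
    (∀ (A B : Finset BaerSpecker) (h : A ≤ B) (p : specProj B →+ specProj A),
      (∀ g : specGroup, p (toSpecProj B g) = toSpecProj A g) ↔ ∀ y, p y = specBond h y) ∧
    InverseSystem (fun _ _ h => ⇑(specBond h)) ∧
    -- the witness is the inverse limit of its projections, through the natural map
    (∃ e : specGroup ≃ₜ+ inverseLimitGroup specBond,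
      ∀ (g : specGroup) (A : Finset BaerSpecker),
        (e g : ∀ A, specProj A) A = toSpecProj A g) ∧
    -- and it is not reflexive
    ¬ IsReflexiveGroup specGroup ∧
    ¬ IsReflexiveGroup (inverseLimitGroup specBond) := by
  refine ⟨not_inverseLimitsReflexive_of_specProj fun A =>
      ⟨specProj.discreteTopology A, specProj.fg A, specProj.isAddTorsionFree A⟩,
    not_inverseLimitsReflexive_of_specProj fun A =>
      ⟨specProj.discreteTopology A, specProj.fg A, specProj.free A⟩,
    not_inverseLimitsReflexive_of_specProj specProj.isCompactlyGeneratedLCA,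
    fun A => ⟨specProj.discreteTopology A, specProj.fg A, specProj.isAddTorsionFree A,
      specProj.free A⟩,
    fun A B h p => ⟨fun hp y => ?_, fun hp g => hp _⟩, inverseSystem_specBond,
    ⟨specGroupEquivLimit, fun _ _ => rfl⟩, specGroup.not_isReflexiveGroup,
    not_isReflexiveGroup_limit⟩
  obtain ⟨g, rfl⟩ := toSpecProj_surjective B y
  exact hp g
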